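/- A field is called real if $-1$ is not a sum of squares in it. For a field $k$ let $p(k)$ denote its Pythagoras number, i.e. the smallest natural number $p$ such that every sum of squares in $k$ is a sum of $p$ squares in $k$, with $p(k)=\infty$ if no such $p$ exists. "A sum of $m$ squares" allows zero summands. Theorem 1.2. Let $K/k$ be an extension of real fields of finite degree $d=[K:k]<\infty$, and assume that every ordering of $k$ extends to $d$ different orderings of $K$. Then there exist sums of squares $c_1,\dots,c_d$ in $k$ with $c_1=1$ and with the following property: for every commutative $k$-algebra $A$, every integer $m\ge 1$ and every $f\in A$ such that $f\otimes 1$ is a sum of $m$ squares in $A_K=A\otimes_k K$, there exist $f_1,\dots,f_d\in A$, each of them a sum of $m$ squares in $A$, such that $$f=\sum_{i=1}^d c_i f_i .$$ In particular, $f$ is a sum of squares in $A$, and if $p(k)<\infty$, then $f$ is a sum of $d\,m\cdot p(k)$ squares in $A$. -/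

import Mathlib

open scoped TensorProduct

/-- `x` is a sum of `n` squares in the ring `R` (zero summands are allowed). -/
def IsSumOfNSquares {R : Type*} [CommRing R] (n : ℕ) (x : R) : Prop :=
  ∃ g : Fin n → R, x = ∑ j, g j ^ 2

/-- The Pythagoras number of `R`: the smallest `p` such that every sum of squares in `R` is a sum
of `p` squares in `R`, and `⊤` if there is no such natural number. -/
noncomputable def pythagorasNumber (R : Type*) [CommRing R] : ℕ∞ :=
  sInf {p : ℕ∞ | ∃ n : ℕ, p = n ∧ ∀ x : R, IsSumSq x → IsSumOfNSquares n x}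

/-- The orderings `Q` of the field `K` which extend the ordering `P` of the subfield `k`,
i.e. whose restriction to `k` is `P`. (Orderings are given by their sets of nonnegative
elements.) -/
def orderingExtensions {k : Type*} (K : Type*) [Field k] [Field K] [Algebra k K]
    (P : RingPreordering k) : Set (RingPreordering K) :=
  {Q | Q.IsOrdering ∧ ∀ x : k, algebraMap k K x ∈ Q ↔ x ∈ P}

/-! For a positive functional `s` on `K` with `s 1 = 1`, an orthogonal basis `1 = e₁, …, e_d` of
the form `s (x y)` gives the theorem with `cᵢ = s (eᵢ²)`: apply `1 ⊗ s` to a sum of squares in `A ⊗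
K`. The functional is `s = d⁻¹ Tr`, so `Tr (x²)` has to be shown nonnegative for every ordering of
`k`.

Fix an ordering of `k`, and let `ρ u` be the signature of the form `Tr (u x²)`. The ordering has at
most `ρ 1` extensions to `K`, so `Tr (x²)` is positive definite if it has `d` of them. Indeed, let
`K` be ordered by an extension. Then `K ⊗ K` is the product of the diagonal factor `K` and of
fields of degree less than `d` over `K`, so `ρ` is the sum of the sign function of this ordering of
`K` and of signatures of lower degree. By induction, `ρ` is a sum of sign functions of extensions,
in which any given one can be made to occur; the induction also needs that `ρ = 0` if there is no
extension, which follows from Witt's relation `⟨a, b⟩ ≅ ⟨a + b, a b (a + b)⟩`. Distinct sign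
functions are distinct characters of `K`, hence linearly independent, so the representation of `ρ`
is unique, every extension occurs in it, and each contributes at least `1` to `ρ 1`. -/

section ScaledTraceForm

variable (k : Type*) {A : Type*} [Field k] [CommRing A] [Algebra k A]

/-- The trace form of the `k`-algebra `A` scaled by `u ∈ A`, i.e. `(x, y) ↦ Tr(u x y)`. -/
noncomputable def scaledTraceForm (u : A) : LinearMap.BilinForm k A :=
  (Algebra.traceForm k A) ∘ₗ LinearMap.mulLeft k u

theorem scaledTraceForm_apply (u x y : A) :
    scaledTraceForm k u x y = Algebra.trace k A (u * x * y) := rfl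

theorem scaledTraceForm_isSymm (u : A) : LinearMap.IsSymm (scaledTraceForm k u) :=
  ⟨fun x y => congrArg (Algebra.trace k A) (mul_right_comm u x y)⟩

theorem exists_basis_isOrthoᵢ_scaledTraceForm [CharZero k] [FiniteDimensional k A] (u : A) :
    ∃ b : Module.Basis (Fin (Module.finrank k A)) k A, (scaledTraceForm k u).IsOrthoᵢ b :=
  have : Invertible (2 : k) := invertibleOfNonzero two_ne_zero
  LinearMap.BilinForm.exists_orthogonal_basis (scaledTraceForm_isSymm k u)

end ScaledTraceForm

section Trace

theorem trace_pi_apply {R ι : Type*} [CommRing R] [Fintype ι] {A : ι → Type*}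
    [∀ i, CommRing (A i)] [∀ i, Algebra R (A i)] [∀ i, Module.Free R (A i)]
    [∀ i, Module.Finite R (A i)] (x : ∀ i, A i) :
    Algebra.trace R (∀ i, A i) x = ∑ i, Algebra.trace R (A i) (x i) := by
  classical
  let b i := Module.Free.chooseBasis R (A i)
  simp_rw [Algebra.trace_eq_matrix_trace (Pi.basis b), fun i => Algebra.trace_eq_matrix_trace (b i),
    Matrix.trace, Matrix.diag_apply, Algebra.leftMulMatrix_eq_repr_mul, Fintype.sum_sigma]
  refine Finset.sum_congr rfl fun i _ => Finset.sum_congr rfl fun j _ => ?_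
  simp [Pi.basis_repr]

theorem trace_one_tmul {R S A : Type*} [CommRing R] [CommRing S] [Algebra R S] [CommRing A]
    [Algebra R A] [Module.Free R A] [Module.Finite R A] (x : A) :
    Algebra.trace S (S ⊗[R] A) (1 ⊗ₜ x) = algebraMap R S (Algebra.trace R A x) := by
  rw [Algebra.trace_apply, Algebra.trace_apply, ← LinearMap.trace_baseChange]
  congr 1
  ext y
  simp

end Trace

section TraceSignature

variable {k A : Type*} [Field k] [LinearOrder k] [CommRing A] [Algebra k A]

variable (k) in
/-- The signature of the quadratic form `x ↦ Tr(u x²)` on `A`: the number of positive minus the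
number of negative entries in a diagonalization. -/
noncomputable def traceSignature (u : A) : ℤ :=
  sigPos (scaledTraceForm k u).toQuadraticMap - sigNeg (scaledTraceForm k u).toQuadraticMap

theorem traceSignature_congr {B : Type*} [CommRing B] [Algebra k B] (e : A ≃ₗ[k] B) {u : A} {v : B}
    (h : ∀ x, Algebra.trace k B (v * e x * e x) = Algebra.trace k A (u * x * x)) :
    traceSignature k u = traceSignature k v := by
  have heq : (scaledTraceForm k u).toQuadraticMap.Equivalent (scaledTraceForm k v).toQuadraticMap :=
    ⟨⟨e, h⟩⟩
  rw [traceSignature, traceSignature, heq.sigPos_eq, heq.sigNeg_eq]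

theorem traceSignature_map_algEquiv {B : Type*} [CommRing B] [Algebra k B] (e : A ≃ₐ[k] B) (u : A) :
    traceSignature k (e u) = traceSignature k u :=
  (traceSignature_congr e.toLinearEquiv fun x => by
    rw [AlgEquiv.toLinearEquiv_apply, ← map_mul, ← map_mul, Algebra.trace_eq_of_algEquiv]).symm

theorem traceSignature_neg (u : A) : traceSignature k (-u) = -traceSignature k u := by
  have : (scaledTraceForm k (-u)).toQuadraticMap = -(scaledTraceForm k u).toQuadraticMap := by
    ext x
    simp [scaledTraceForm_apply]
  rw [traceSignature, traceSignature, this, sigPos_neg, sigNeg_neg, neg_sub]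

theorem traceSignature_zero : traceSignature k (0 : A) = 0 :=
  self_eq_neg.mp <| by rw [← traceSignature_neg, neg_zero]

theorem traceSignature_mul_mul_self {u x : A} (hx : IsUnit x) :
    traceSignature k (u * (x * x)) = traceSignature k u :=
  traceSignature_congr (DistribMulAction.toLinearEquiv k A hx.unit) fun y => by
    congr 1
    simp only [DistribMulAction.toLinearEquiv_apply, Units.smul_def, IsUnit.unit_spec, smul_eq_mul]
    ring

theorem abs_traceSignature_le (u : A) : |traceSignature k u| ≤ Module.finrank k A :=
  abs_sub_le_of_nonneg_of_le (Nat.cast_nonneg _) (Nat.cast_le.mpr (sigPos_le_finrank _))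
    (Nat.cast_nonneg _) (Nat.cast_le.mpr (sigPos_le_finrank _))

theorem trace_mul_self_nonneg_of_traceSignature_eq [FiniteDimensional k A]
    (h : traceSignature k (1 : A) = Module.finrank k A) (x : A) :
    0 ≤ Algebra.trace k A (x * x) := by
  let q := (scaledTraceForm k (1 : A)).toQuadraticMap
  have hrank : sigPos q = Module.finrank k A :=
    (sigPos_le_finrank q).antisymm (by rw [traceSignature] at h; lia)
  obtain ⟨V, hV, hpos⟩ := exists_finrank_eq_sigPos_and_posDef q
  have hx : x ∈ V := Submodule.eq_top_of_finrank_eq (hV.trans hrank) ▸ Submodule.mem_top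
  simpa [q, scaledTraceForm_apply] using hpos.nonneg ⟨x, hx⟩

variable [IsStrictOrderedRing k]

theorem traceSignature_eq_sum_sign {ι : Type*} [Fintype ι] {u : A} {b : Module.Basis ι k A}
    (hb : (scaledTraceForm k u).IsOrthoᵢ b) :
    traceSignature k u = ∑ i, (SignType.sign (scaledTraceForm k u (b i) (b i)) : ℤ) := by
  classical
  have : Invertible (2 : k) := invertibleOfNonzero two_ne_zero
  let w i := scaledTraceForm k u (b i) (b i)
  have heq : (scaledTraceForm k u).toQuadraticMap.Equivalent
      (QuadraticMap.weightedSumSquares k w) := by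
    have hort : (QuadraticMap.associated (R := k)
        (scaledTraceForm k u).toQuadraticMap).IsOrthoᵢ b := by
      rwa [QuadraticMap.associated_left_inverse _ (scaledTraceForm_isSymm k u).eq]
    exact QuadraticMap.basisRepr_eq_of_iIsOrtho _ b hort ▸
      ⟨QuadraticMap.isometryEquivBasisRepr _ b⟩
  rw [traceSignature, QuadraticForm.sigPos_of_equiv_weightedSumSquares heq,
    QuadraticForm.sigNeg_of_equiv_weightedSumSquares heq, Set.ncard_eq_toFinset_card',
    Set.ncard_eq_toFinset_card']
  simp only [Set.toFinset_ofPred, Finset.card_filter, Nat.cast_sum, ← Finset.sum_sub_distrib]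
  refine Finset.sum_congr rfl fun i _ => ?_
  change _ = (SignType.sign (w i) : ℤ)
  rcases lt_trichotomy (w i) 0 with h | h | h <;> simp [h, h.not_gt]

theorem traceSignature_self (u : k) : traceSignature k u = SignType.sign u := by
  rw [traceSignature_eq_sum_sign (b := Module.Basis.singleton Unit k)
    fun i j hij => (hij (Subsingleton.elim i j)).elim]
  simp [scaledTraceForm_apply]

theorem traceSignature_mul_algebraMap [FiniteDimensional k A] (u : A) {c : k} (hc : 0 < c) :
    traceSignature k (u * algebraMap k A c) = traceSignature k u := by
  have hform (x y : A) : scaledTraceForm k (u * algebraMap k A c) x y =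
      c * scaledTraceForm k u x y := by
    rw [scaledTraceForm_apply, scaledTraceForm_apply, mul_comm u, mul_assoc, mul_assoc,
      ← Algebra.smul_def, map_smul, smul_eq_mul, mul_assoc]
  obtain ⟨b, hb⟩ := exists_basis_isOrthoᵢ_scaledTraceForm k u
  have hb' : (scaledTraceForm k (u * algebraMap k A c)).IsOrthoᵢ b := fun i j hij =>
    (hform _ _).trans (mul_eq_zero_of_right c (hb hij))
  simp_rw [traceSignature_eq_sum_sign hb', traceSignature_eq_sum_sign hb, hform, sign_mul,
    sign_pos hc, one_mul]

theorem traceSignature_pi {ι : Type*} [Fintype ι] {B : ι → Type*} [∀ i, CommRing (B i)]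
    [∀ i, Algebra k (B i)] [∀ i, FiniteDimensional k (B i)] (u : ∀ i, B i) :
    traceSignature k u = ∑ i, traceSignature k (u i) := by
  classical
  have hform (x y : ∀ i, B i) : scaledTraceForm k u x y =
      ∑ i, scaledTraceForm k (u i) (x i) (y i) := trace_pi_apply _
  have hsingle (i : ι) (x : B i) (y : ∀ i, B i) :
      scaledTraceForm k u (Pi.single i x) y = scaledTraceForm k (u i) x (y i) := by
    rw [hform, Finset.sum_eq_single i (fun j _ hj => by simp [Pi.single_eq_of_ne hj]) (by simp),
      Pi.single_eq_same]
  choose b hb using fun i => exists_basis_isOrthoᵢ_scaledTraceForm k (u i)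
  have hort : (scaledTraceForm k u).IsOrthoᵢ (Pi.basis b) := by
    rintro ⟨i, r⟩ ⟨j, s⟩ hij
    change scaledTraceForm k u _ _ = 0
    rw [Pi.basis_apply, Pi.basis_apply, hsingle]
    rcases eq_or_ne i j with rfl | h
    · rw [Pi.single_eq_same]
      exact hb i fun hrs => hij (congrArg _ hrs)
    · rw [Pi.single_eq_of_ne h, map_zero]
  simp_rw [traceSignature_eq_sum_sign hort, fun i => traceSignature_eq_sum_sign (hb i),
    Fintype.sum_sigma, Pi.basis_apply, hsingle, Pi.single_eq_same]

theorem traceSignature_one_tmul {K : Type*} [Field K] [LinearOrder K] [IsStrictOrderedRing K]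
    [Algebra k K] (hK : StrictMono (algebraMap k K)) [FiniteDimensional k A] (u : A) :
    traceSignature K ((1 : K) ⊗ₜ[k] u) = traceSignature k u := by
  obtain ⟨b, hb⟩ := exists_basis_isOrthoᵢ_scaledTraceForm k u
  have hform (i j) : scaledTraceForm K ((1 : K) ⊗ₜ[k] u) (b.baseChange K i) (b.baseChange K j) =
      algebraMap k K (scaledTraceForm k u (b i) (b j)) := by
    simp [scaledTraceForm_apply, ← trace_one_tmul]
  have hort : (scaledTraceForm K ((1 : K) ⊗ₜ[k] u)).IsOrthoᵢ (b.baseChange K) := fun i j hij =>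
    (hform i j).trans ((congrArg _ (hb hij)).trans (map_zero _))
  simp_rw [traceSignature_eq_sum_sign hort, traceSignature_eq_sum_sign hb, hform,
    hK.sign_comp]

end TraceSignature

section Orderings

variable {F : Type*} [Field F]

/-- The preordering `P + a P` generated by a preordering `P` and an element `a` with `-a ∉ P`. -/
def adjoinPreordering (P : RingPreordering F) {a : F} (ha : -a ∉ P) : RingPreordering F :=
  RingPreordering.mk' {x | ∃ s ∈ P, ∃ t ∈ P, x = s + a * t}
    (by
      rintro _ _ ⟨s, hs, t, ht, rfl⟩ ⟨s', hs', t', ht', rfl⟩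
      exact ⟨s + s', add_mem hs hs', t + t', add_mem ht ht', by ring⟩)
    (by
      rintro _ _ ⟨s, hs, t, ht, rfl⟩ ⟨s', hs', t', ht', rfl⟩
      exact ⟨s * s' + a * a * (t * t'),
        add_mem (mul_mem hs hs') (mul_mem (P.mul_self_mem a) (mul_mem ht ht')),
        s * t' + t * s', add_mem (mul_mem hs ht') (mul_mem ht hs'), by ring⟩)
    (fun x => ⟨x * x, P.mul_self_mem x, 0, zero_mem P, by ring⟩)
    (by
      rintro ⟨s, hs, t, ht, h⟩
      have ht0 : t ≠ 0 := by
        rintro rfl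
        exact P.neg_one_notMem (by rwa [h, mul_zero, add_zero])
      have hneg : -a = (1 + s) * t⁻¹ := by
        rw [eq_mul_inv_iff_mul_eq₀ ht0]
        linear_combination h
      exact ha (hneg ▸ mul_mem (add_mem (one_mem P) hs) (RingPreordering.inv_mem ht)))

theorem le_adjoinPreordering (P : RingPreordering F) {a : F} (ha : -a ∉ P) :
    P ≤ adjoinPreordering P ha :=
  fun x hx => ⟨x, hx, 0, zero_mem P, by ring⟩

theorem self_mem_adjoinPreordering (P : RingPreordering F) {a : F} (ha : -a ∉ P) :
    a ∈ adjoinPreordering P ha :=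
  ⟨0, zero_mem P, 1, one_mem P, by ring⟩

theorem exists_le_isOrdering (T : RingPreordering F) :
    ∃ Q : RingPreordering F, T ≤ Q ∧ Q.IsOrdering := by
  obtain ⟨Q, hTQ, hQ⟩ := zorn_le_nonempty_Ici₀ T (fun c _ hc R hR => by
    refine ⟨RingPreordering.mk' {x | ∃ P ∈ c, x ∈ P} ?_ ?_ (fun x => ⟨R, hR, R.mul_self_mem x⟩)
      fun ⟨P, _, h⟩ => P.neg_one_notMem h, fun P hP x hx => ⟨P, hP, hx⟩⟩
    all_goals
      rintro x y ⟨P, hP, hx⟩ ⟨P', hP', hy⟩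
      obtain ⟨P'', hP'', hle, hle'⟩ := hc.directedOn P hP P' hP'
    · exact ⟨P'', hP'', add_mem (hle hx) (hle' hy)⟩
    · exact ⟨P'', hP'', mul_mem (hle hx) (hle' hy)⟩) T le_rfl
  have : HasMemOrNegMem Q := ⟨fun x => or_iff_not_imp_right.mpr fun hx =>
    hQ (le_adjoinPreordering Q hx) (self_mem_adjoinPreordering Q hx)⟩
  exact ⟨Q, hTQ, {}⟩

theorem isSumSq_of_forall_mem_isOrdering [IsSemireal F] {x : F}
    (hx : ∀ P : RingPreordering F, P.IsOrdering → x ∈ P) : IsSumSq x := by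
  by_contra hn
  let T : RingPreordering F := .mk' {y | IsSumSq y} .add .mul IsSumSq.mul_self
    (IsSemireal.not_isSumSq_neg_one F)
  have hT : - -x ∉ T := by rwa [neg_neg]
  obtain ⟨Q, hTQ, hQ⟩ := exists_le_isOrdering (adjoinPreordering T hT)
  exact hn (RingPreordering.eq_zero_of_mem_of_neg_mem (hx Q hQ)
    (hTQ (self_mem_adjoinPreordering T hT)) ▸ .zero)

variable (F) in
/-- The ordering of a linearly ordered field given by its nonnegative elements. -/
def nonnegPreordering [LinearOrder F] [IsStrictOrderedRing F] : RingPreordering F where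
  __ := Subsemiring.nonneg F
  mem_of_isSquare' hx := hx.nonneg
  neg_one_notMem' h := neg_one_lt_zero.not_ge h

theorem mem_nonnegPreordering [LinearOrder F] [IsStrictOrderedRing F] {x : F} :
    x ∈ nonnegPreordering F ↔ 0 ≤ x := .rfl

theorem exists_nonnegPreordering_eq {P : RingPreordering F} (hP : P.IsOrdering) :
    ∃ (_ : LinearOrder F) (_ : IsStrictOrderedRing F), nonnegPreordering F = P := by
  classical
  let C : RingCone F :=
    { P.toSubsemiring with
      eq_zero_of_mem_of_neg_mem' := fun h h' =>
        RingPreordering.eq_zero_of_mem_of_neg_mem (P := P) h h' }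
  have : HasMemOrNegMem C := ⟨hP.mem_or_neg_mem⟩
  let _ : LinearOrder F := LinearOrder.mkOfAddGroupCone C
  have : IsOrderedRing F := IsOrderedRing.mkOfCone C
  refine ⟨inferInstance, IsOrderedRing.toIsStrictOrderedRing F, SetLike.ext fun x => ?_⟩
  change x - 0 ∈ C ↔ x ∈ P
  rw [sub_zero]
  rfl

/-- The sign `-1`, `0` or `1` of an element with respect to an ordering. -/
noncomputable def orderSign (Q : RingPreordering F) (x : F) : ℤ :=
  open Classical in if x ∈ Q then if -x ∈ Q then 0 else 1 else -1

theorem orderSign_nonnegPreordering [LinearOrder F] [IsStrictOrderedRing F] (x : F) :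
    orderSign (nonnegPreordering F) x = SignType.sign x := by
  rcases lt_trichotomy x 0 with h | h | h <;>
    simp [orderSign, mem_nonnegPreordering, h, le_of_lt, not_le_of_gt]

theorem orderSign_nonneg_iff {Q : RingPreordering F} {x : F} : 0 ≤ orderSign Q x ↔ x ∈ Q := by
  unfold orderSign
  split_ifs <;> simp_all

theorem orderSign_one (Q : RingPreordering F) : orderSign Q 1 = 1 := by
  simp [orderSign, one_mem, Q.neg_one_notMem]

theorem linearIndependent_orderSign {S : Set (RingPreordering F)} (hS : ∀ Q ∈ S, Q.IsOrdering) :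
    LinearIndependent ℕ fun Q : S => orderSign (Q : RingPreordering F) := by
  have hhom (Q : S) : ∃ χ : F →* ℤ, ⇑χ = orderSign (Q : RingPreordering F) := by
    obtain ⟨_, _, hQ⟩ := exists_nonnegPreordering_eq (hS Q Q.2)
    refine ⟨(SignType.castHom.comp signHom : F →*₀ ℤ), funext fun x => ?_⟩
    rw [← hQ, orderSign_nonnegPreordering]
    rfl
  choose χ hχ using hhom
  have hinj : Function.Injective χ := fun Q Q' h => Subtype.ext <| SetLike.ext fun x => by
    rw [← orderSign_nonneg_iff, ← orderSign_nonneg_iff, ← hχ, ← hχ, h]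
  have := (linearIndependent_monoidHom F ℤ).comp χ hinj
  simp only [Function.comp_def, hχ] at this
  exact this.restrict_scalars fun a b h => by simpa using h

/-- The preimage of a preordering under a homomorphism of fields. -/
def comapPreordering {E : Type*} [Field E] (φ : F →+* E) (Q : RingPreordering E) :
    RingPreordering F where
  __ := Q.toSubsemiring.comap φ
  mem_of_isSquare' hx := Q.mem_of_isSquare (hx.map φ)
  neg_one_notMem' h := Q.neg_one_notMem (by simpa using h)

theorem isOrdering_comapPreordering {E : Type*} [Field E] (φ : F →+* E) {Q : RingPreordering E}
    (hQ : Q.IsOrdering) : (comapPreordering φ Q).IsOrdering :=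
  have : HasMemOrNegMem (comapPreordering φ Q) :=
    ⟨fun x => (map_neg φ x ▸ hQ.mem_or_neg_mem (φ x) : φ x ∈ Q ∨ φ (-x) ∈ Q)⟩
  {}

theorem orderSign_comapPreordering {E : Type*} [Field E] (φ : F →+* E) (Q : RingPreordering E) :
    orderSign (comapPreordering φ Q) = orderSign Q ∘ φ := by
  ext x
  rw [Function.comp_apply, orderSign, orderSign, ← map_neg]
  rfl

end Orderings

section Knebusch

theorem traceSignature_add_traceSignature {k K : Type*} [Field k] [LinearOrder k]
    [IsStrictOrderedRing k] [Field K] [Algebra k K] [FiniteDimensional k K] {a b : K}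
    (hab : a + b ≠ 0) :
    traceSignature k a + traceSignature k b =
      traceSignature k (a + b) + traceSignature k (a * b * (a + b)) := by
  let e : (Fin 2 → K) ≃ₗ[k] (Fin 2 → K) := LinearEquiv.restrictScalars k <|
    Matrix.toLin'OfInv (M := (a + b)⁻¹ • !![a, b; -1, 1]) (M' := !![1, -b; 1, a])
      (by ext i j; fin_cases i <;> fin_cases j <;> simp <;> field_simp <;> ring)
      (by ext i j; fin_cases i <;> fin_cases j <;> simp <;> field_simp <;> ring)
  have he (x : Fin 2 → K) : e x = ![x 0 - b * x 1, x 0 + a * x 1] := by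
    ext i
    fin_cases i <;> simp [e, Matrix.vecHead, Matrix.vecTail, sub_eq_add_neg]
  have := traceSignature_congr e (u := ![a + b, a * b * (a + b)]) (v := ![a, b]) fun x => by
    rw [he, trace_pi_apply, trace_pi_apply, Fin.sum_univ_two, Fin.sum_univ_two, ← map_add,
      ← map_add]
    congr 1
    simp only [Pi.mul_apply, Matrix.cons_val_zero, Matrix.cons_val_one]
    ring
  rw [traceSignature_pi, traceSignature_pi] at this
  simpa using this.symm

theorem orderingExtensions_nonempty_of_algebraMap_mem {k K : Type*} [Field k] [LinearOrder k]
    [IsStrictOrderedRing k] [Field K] [Algebra k K] {T : RingPreordering K}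
    (hT : ∀ c : k, 0 ≤ c → algebraMap k K c ∈ T) :
    (orderingExtensions K (nonnegPreordering k)).Nonempty := by
  obtain ⟨Q, hTQ, hQ⟩ := exists_le_isOrdering T
  refine ⟨Q, hQ, fun c => ⟨fun hc => ?_, fun hc => hTQ (hT c hc)⟩⟩
  by_contra hneg
  rw [mem_nonnegPreordering, not_le] at hneg
  have hc' : -algebraMap k K c ∈ Q := map_neg (algebraMap k K) c ▸ hTQ (hT _ (neg_pos.mpr hneg).le)
  exact hneg.ne ((map_eq_zero _).mp (RingPreordering.eq_zero_of_mem_of_neg_mem hc hc'))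

theorem exists_forall_traceSignature_le {k K : Type*} [Field k] [LinearOrder k] [Field K]
    [Algebra k K] [FiniteDimensional k K] {v : K} (hv : traceSignature k v ≠ 0) :
    ∃ w : K, (∀ u : K, traceSignature k u ≤ traceSignature k w) ∧ 0 < traceSignature k w := by
  have hfin : (Set.range (traceSignature k : K → ℤ)).Finite :=
    (Set.finite_Icc _ _).subset <| Set.range_subset_iff.mpr fun u =>
      abs_le.mp (abs_traceSignature_le u)
  obtain ⟨_, ⟨w, rfl⟩, hw⟩ := Set.exists_max_image _ id hfin (Set.range_nonempty _)
  simp only [Set.forall_mem_range, id] at hw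
  have hneg := hw (-v)
  rw [traceSignature_neg] at hneg
  exact ⟨w, hw, by grind⟩

theorem traceSignature_add_eq_of_forall_le {k K : Type*} [Field k] [LinearOrder k]
    [IsStrictOrderedRing k] [Field K] [Algebra k K] [FiniteDimensional k K] {w a b : K}
    (hw : ∀ u : K, traceSignature k u ≤ traceSignature k w)
    (ha : traceSignature k a = traceSignature k w) (hb : traceSignature k b = traceSignature k w)
    (hab : a + b ≠ 0) : traceSignature k (a + b) = traceSignature k w := by
  have hwitt := traceSignature_add_traceSignature (k := k) hab
  have hle := hw (a + b)
  have hle' := hw (a * b * (a + b))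
  lia

theorem exists_algebraMap_mem_of_traceSignature_ne_zero {k K : Type*} [Field k] [LinearOrder k]
    [IsStrictOrderedRing k] [Field K] [Algebra k K] [FiniteDimensional k K] {v : K}
    (hv : traceSignature k v ≠ 0) :
    ∃ T : RingPreordering K, ∀ c : k, 0 ≤ c → algebraMap k K c ∈ T := by
  obtain ⟨w, hw, hpos⟩ := exists_forall_traceSignature_le hv
  -- `T` consists of the elements which preserve the property of having maximal signature.
  refine ⟨.mk' {a | a = 0 ∨ ∀ u : K, traceSignature k u = traceSignature k w →
    traceSignature k (u * a) = traceSignature k w} ?add ?mul ?sq ?neg_one, fun c hc => ?nonneg⟩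
  case add =>
    rintro a b (rfl | ha) hb
    · rwa [zero_add]
    rcases hb with rfl | hb
    · exact .inr (by rwa [add_zero])
    refine or_iff_not_imp_left.mpr fun hab u hu => ?_
    have hu0 : u ≠ 0 := by
      rintro rfl
      exact hpos.ne (traceSignature_zero.symm.trans hu)
    rw [mul_add]
    exact traceSignature_add_eq_of_forall_le hw (ha u hu) (hb u hu)
      (mul_add u a b ▸ mul_ne_zero hu0 hab)
  case mul =>
    rintro a b (rfl | ha) hb
    · exact .inl (zero_mul b)
    rcases hb with rfl | hb
    · exact .inl (mul_zero a)
    exact .inr fun u hu => by rw [← mul_assoc]; exact hb _ (ha u hu)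
  case sq =>
    refine fun a => or_iff_not_imp_left.mpr fun ha u hu => ?_
    rwa [traceSignature_mul_mul_self (IsUnit.mk0 a (left_ne_zero_of_mul ha))]
  case neg_one =>
    rintro (h | h)
    · exact neg_ne_zero.mpr one_ne_zero h
    · have := h w rfl
      rw [mul_neg_one, traceSignature_neg] at this
      lia
  case nonneg =>
    rcases hc.eq_or_lt with rfl | hc
    · exact .inl (map_zero _)
    · exact .inr fun u hu => by rwa [traceSignature_mul_algebraMap u hc]

theorem exists_algHom_comp_eval {R ι F : Type*} [CommRing R] [Finite ι] {B : ι → Type*}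
    [∀ i, CommRing (B i)] [∀ i, Algebra R (B i)] [CommRing F] [IsDomain F] [Algebra R F]
    (f : (∀ i, B i) →ₐ[R] F) : ∃ (i : ι) (g : B i →ₐ[R] F), ∀ x, f x = g (x i) := by
  classical
  have := Fintype.ofFinite ι
  obtain ⟨i, hi⟩ : ∃ i, f (Pi.single i 1) ≠ 0 := by
    by_contra! h
    have : f (∑ i, Pi.single i 1) = 0 := by rw [map_sum, Finset.sum_eq_zero fun i _ => h i]
    rw [Finset.univ_sum_single fun i => (1 : B i)] at this
    exact one_ne_zero ((map_one f).symm.trans this)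
  have hmul (x y : B i) : f (Pi.single i (x * y)) = f (Pi.single i x) * f (Pi.single i y) := by
    rw [← map_mul, ← Pi.single_mul]
  have hone : f (Pi.single i 1) = 1 := mul_left_cancel₀ hi (by rw [← hmul, mul_one, mul_one])
  refine ⟨i, .ofLinearMap (f.toLinearMap ∘ₗ LinearMap.single R B i) hone hmul, fun x => ?_⟩
  change f x = f (Pi.single i (x i))
  rw [← mul_one (f x), ← hone, ← map_mul]
  congr 1
  ext j
  rcases eq_or_ne j i with rfl | h <;> simp [*]

theorem exists_algEquiv_apply_one_tmul {k K ι : Type*} [Field k] [Field K] [Algebra k K] [Finite ι]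
    {L : ι → Type*} [∀ i, Field (L i)] [∀ i, Algebra K (L i)] (e : K ⊗[k] K ≃ₐ[K] ∀ i, L i) :
    ∃ (i : ι) (g : L i ≃ₐ[K] K), ∀ u, g (e (1 ⊗ₜ u) i) = u := by
  obtain ⟨i, g, hg⟩ := exists_algHom_comp_eval
    ((Algebra.TensorProduct.lmul'' k (S := K)).comp e.symm.toAlgHom)
  have hbij : Function.Bijective g := ⟨g.injective, fun x => ⟨algebraMap K (L i) x, g.commutes x⟩⟩
  refine ⟨i, .ofBijective g hbij, fun u => (hg _).symm.trans ?_⟩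
  simp [Algebra.TensorProduct.lmul'']

universe u v

theorem exists_traceSignature_eq_sign_add_sum {k : Type u} {K : Type v} [Field k] [LinearOrder k]
    [IsStrictOrderedRing k] [Field K] [LinearOrder K] [IsStrictOrderedRing K] [Algebra k K]
    [FiniteDimensional k K] (hK : StrictMono (algebraMap k K)) :
    ∃ (ι : Type v) (_ : Fintype ι) (L : ι → Type v) (_ : ∀ i, Field (L i))
      (_ : ∀ i, Algebra K (L i)) (φ : ∀ i, K →+* L i),
      (∀ i, FiniteDimensional K (L i)) ∧
      (∀ i, Module.finrank K (L i) < Module.finrank k K) ∧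
      (∀ i x, φ i (algebraMap k K x) = algebraMap K (L i) (algebraMap k K x)) ∧
      ∀ u : K, traceSignature k u = SignType.sign u + ∑ i, traceSignature K (φ i u) := by
  classical
  have : Algebra.FormallyEtale k K := Algebra.FormallyEtale.of_isSeparable k K
  obtain ⟨I, _, L, _, _, e, -⟩ :=
    (Algebra.FormallyEtale.iff_exists_algEquiv_prod K (K ⊗[k] K)).mp inferInstance
  have := Fintype.ofFinite I
  have hfin (i : I) : FiniteDimensional K (L i) :=
    .of_surjective (LinearMap.proj i ∘ₗ e.toLinearMap)
      ((Function.surjective_eval i).comp e.surjective)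
  have hsum : ∑ i, Module.finrank K (L i) = Module.finrank k K := by
    rw [← Module.finrank_pi_fintype, ← e.toLinearEquiv.finrank_eq, Module.finrank_baseChange]
  obtain ⟨i₀, g, hg⟩ := exists_algEquiv_apply_one_tmul e
  refine ⟨{i // i ≠ i₀}, inferInstance, fun i => L i, inferInstance, inferInstance, fun i =>
    ((Pi.evalRingHom L i).comp e.toRingEquiv.toRingHom).comp
      Algebra.TensorProduct.includeRight.toRingHom, fun i => hfin i, fun i => ?_, fun i x => ?_,
    fun u => ?_⟩
  · rw [← hsum, Fintype.sum_eq_add_sum_subtype_ne _ i₀]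
    exact (Finset.single_le_sum (f := fun j : {j // j ≠ i₀} => Module.finrank K (L j))
      (fun _ _ => Nat.zero_le _) (Finset.mem_univ i)).trans_lt
      (lt_add_of_pos_left _ Module.finrank_pos)
  · change e (1 ⊗ₜ algebraMap k K x) i = _
    rw [← Algebra.TensorProduct.tmul_one_eq_one_tmul]
    exact congrFun (e.commutes _) i
  · rw [← traceSignature_one_tmul hK, ← traceSignature_map_algEquiv e, traceSignature_pi,
      Fintype.sum_eq_add_sum_subtype_ne _ i₀,
      ← traceSignature_map_algEquiv g, hg, traceSignature_self]
    rfl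

/-- The additive cone of functions on `K` generated by the sign functions of the orderings of `K`
which extend the ordering of `k`. -/
def signCone (k K : Type*) [Field k] [LinearOrder k] [IsStrictOrderedRing k] [Field K]
    [Algebra k K] : Submodule ℕ (K → ℤ) :=
  .span ℕ (Set.range fun Q : orderingExtensions K (nonnegPreordering k) =>
    orderSign (Q : RingPreordering K))

theorem comp_mem_signCone {k K E L : Type*} [Field k] [LinearOrder k] [IsStrictOrderedRing k]
    [Field K] [Algebra k K] [Field E] [LinearOrder E] [IsStrictOrderedRing E] [Field L]
    [Algebra E L] {ψ : k →+* E} (hψ : StrictMono ψ) {φ : K →+* L}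
    (h : ∀ x, φ (algebraMap k K x) = algebraMap E L (ψ x)) {f : L → ℤ} (hf : f ∈ signCone E L) :
    f ∘ φ ∈ signCone k K := by
  induction hf using Submodule.span_induction with
  | zero => exact zero_mem _
  | add _ _ _ _ hf hg => exact add_mem hf hg
  | smul n _ _ hf => exact Submodule.smul_mem _ n hf
  | mem f hf =>
    obtain ⟨⟨Q, hQ, hQE⟩, rfl⟩ := hf
    rw [← orderSign_comapPreordering]
    refine Submodule.subset_span
      ⟨⟨comapPreordering φ Q, isOrdering_comapPreordering φ hQ, fun x => ?_⟩, rfl⟩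
    change φ (algebraMap k K x) ∈ Q ↔ 0 ≤ x
    rw [h, hQE, mem_nonnegPreordering, ← map_zero ψ, hψ.le_iff_le]

section

variable {k : Type u} {K : Type v} [Field k] [LinearOrder k] [IsStrictOrderedRing k] [Field K]
  [Algebra k K] [FiniteDimensional k K]

theorem traceSignature_mem_signCone_of_forall
    (h : ∀ Q ∈ orderingExtensions K (nonnegPreordering k),
      ∃ f ∈ signCone k K, traceSignature k = orderSign Q + f) :
    traceSignature k ∈ signCone k K := by
  rcases (orderingExtensions K (nonnegPreordering k)).eq_empty_or_nonempty with hempty | ⟨Q, hQ⟩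
  · convert zero_mem (signCone k K)
    ext u
    by_contra hu
    obtain ⟨T, hT⟩ := exists_algebraMap_mem_of_traceSignature_ne_zero hu
    exact (orderingExtensions_nonempty_of_algebraMap_mem hT).ne_empty hempty
  · obtain ⟨f, hf, hfQ⟩ := h Q hQ
    exact hfQ ▸ add_mem (Submodule.subset_span ⟨⟨Q, hQ⟩, rfl⟩) hf

theorem exists_traceSignature_eq_orderSign_add_of_forall
    (ih : ∀ (E L : Type v) [Field E] [LinearOrder E] [IsStrictOrderedRing E] [Field L]
      [Algebra E L] [FiniteDimensional E L], Module.finrank E L < Module.finrank k K →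
      traceSignature E ∈ signCone E L)
    {Q : RingPreordering K} (hQ : Q ∈ orderingExtensions K (nonnegPreordering k)) :
    ∃ f ∈ signCone k K, traceSignature k = orderSign Q + f := by
  obtain ⟨_, _, rfl⟩ := exists_nonnegPreordering_eq hQ.1
  have hK : StrictMono (algebraMap k K) :=
    Monotone.strictMono_of_injective
      ((monotone_iff_map_nonneg _).mpr fun x hx => (hQ.2 x).mpr hx) (algebraMap k K).injective
  obtain ⟨ι, _, L, _, _, φ, _, hlt, hφ, heq⟩ := exists_traceSignature_eq_sign_add_sum hK
  refine ⟨∑ i, traceSignature K ∘ φ i,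
    sum_mem fun i _ => comp_mem_signCone hK (hφ i) (ih K (L i) (hlt i)), funext fun u => ?_⟩
  simp [heq, orderSign_nonnegPreordering]

theorem exists_traceSignature_eq_orderSign_add {Q : RingPreordering K}
    (hQ : Q ∈ orderingExtensions K (nonnegPreordering k)) :
    ∃ f ∈ signCone k K, traceSignature k = orderSign Q + f := by
  -- The factors of `K ⊗ K` live in the universe of `K`, so the induction runs inside that universe.
  have hlower (n : ℕ) : ∀ (E L : Type v) [Field E] [LinearOrder E] [IsStrictOrderedRing E] [Field L]
      [Algebra E L] [FiniteDimensional E L], Module.finrank E L < n →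
      traceSignature E ∈ signCone E L := by
    induction n with
    | zero => exact fun _ _ _ _ _ _ _ _ h => absurd h (Nat.not_lt_zero _)
    | succ n ih =>
      exact fun E L _ _ _ _ _ _ hn => traceSignature_mem_signCone_of_forall fun Q =>
        exists_traceSignature_eq_orderSign_add_of_forall fun E' L' _ _ _ _ _ _ h =>
          ih E' L' (h.trans_le (Nat.lt_succ_iff.mp hn))
  exact exists_traceSignature_eq_orderSign_add_of_forall (hlower _) hQ

theorem ncard_orderingExtensions_le :
    ((orderingExtensions K (nonnegPreordering k)).ncard : ℤ) ≤ traceSignature k (1 : K) := by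
  set S := orderingExtensions K (nonnegPreordering k)
  have hmem : traceSignature k ∈ signCone k K :=
    traceSignature_mem_signCone_of_forall fun Q => exists_traceSignature_eq_orderSign_add
  obtain ⟨a, ha⟩ := Finsupp.mem_span_range_iff_exists_finsupp.mp hmem
  have hpos (Q : S) : 1 ≤ a Q := by
    obtain ⟨f, hf, hfQ⟩ := exists_traceSignature_eq_orderSign_add Q.2
    obtain ⟨b, rfl⟩ := Finsupp.mem_span_range_iff_exists_finsupp.mp hf
    have hab : a = Finsupp.single Q 1 + b :=
      linearIndependent_orderSign (S := S) (fun Q hQ => hQ.1) <| by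
        rw [map_add, Finsupp.linearCombination_single, one_smul]
        exact ha.trans hfQ
    rw [hab, Finsupp.add_apply, Finsupp.single_eq_same]
    exact Nat.le_add_right 1 _
  have hsupp (Q : S) : Q ∈ a.support :=
    Finsupp.mem_support_iff.mpr (Nat.one_le_iff_ne_zero.mp (hpos Q))
  have : Fintype S := ⟨a.support, hsupp⟩
  rw [Set.ncard_eq_toFinset_card', Set.toFinset_card, ← ha, Finsupp.sum_fintype _ _ (by simp),
    Finset.sum_apply, Fintype.card_eq_sum_ones, Nat.cast_sum]
  refine Finset.sum_le_sum fun Q _ => ?_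
  simpa [orderSign_one] using hpos Q

end

theorem trace_mul_self_mem_of_encard_orderingExtensions {k K : Type*} [Field k] [Field K]
    [Algebra k K] [FiniteDimensional k K] {P : RingPreordering k} (hP : P.IsOrdering)
    (hcard : (orderingExtensions K P).encard = Module.finrank k K) (x : K) :
    Algebra.trace k K (x * x) ∈ P := by
  obtain ⟨_, _, rfl⟩ := exists_nonnegPreordering_eq hP
  refine trace_mul_self_nonneg_of_traceSignature_eq
    (le_antisymm (le_of_abs_le (abs_traceSignature_le 1)) ?_) x
  rw [← ENat.toNat_natCast (Module.finrank k K), ← hcard]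
  exact ncard_orderingExtensions_le

end Knebusch

section Orthogonal

theorem exists_orthogonal_span_eq_top {k K : Type*} [Field k] [CommRing K] [Algebra k K]
    [FiniteDimensional k K] (h2 : (2 : k) ≠ 0)
    (s : K →ₗ[k] k) (hs : s 1 = 1) {d : ℕ} (hd : Module.finrank k K = d) (h0 : 0 < d) :
    ∃ e : Fin d → K, e ⟨0, h0⟩ = 1 ∧ Submodule.span k (Set.range e) = ⊤ ∧
      ∀ i j, i ≠ j → s (e i * e j) = 0 := by
  have hrank : Module.finrank k (LinearMap.ker s) + 1 = d := by
    have hsurj : LinearMap.range s = ⊤ := LinearMap.range_eq_top.mpr fun a =>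
      ⟨a • 1, by rw [map_smul, hs, smul_eq_mul, mul_one]⟩
    have := s.finrank_range_add_finrank_ker
    rw [hsurj, finrank_top, Module.finrank_self] at this
    omega
  subst hrank
  let B : LinearMap.BilinForm k (LinearMap.ker s) :=
    ((LinearMap.mul k K).compr₂ s).domRestrict₁₂ _ _
  have hB : ∀ x y, B x y = s (x * y) := fun _ _ => rfl
  have : Invertible (2 : k) := invertibleOfNonzero h2
  obtain ⟨v, hv⟩ := LinearMap.BilinForm.exists_orthogonal_basis (B := B)
    ⟨fun x y => by rw [hB, hB, mul_comm]; rfl⟩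
  refine ⟨Fin.cons 1 fun j => (v j : K), rfl, ?_, ?_⟩
  · refine eq_top_iff.mpr fun x _ => ?_
    have hx : x - s x • 1 ∈ LinearMap.ker s := by
      rw [LinearMap.mem_ker, map_sub, map_smul, hs, smul_eq_mul, mul_one, sub_self]
    have hsum : ∑ j, v.repr ⟨_, hx⟩ j • (v j : K) = x - s x • 1 := by
      simpa only [map_sum, map_smul, Submodule.subtype_apply] using
        congrArg (LinearMap.ker s).subtype (v.sum_repr ⟨_, hx⟩)
    rw [← sub_add_cancel x (s x • 1), ← hsum]
    exact add_mem
      (sum_mem fun j _ => Submodule.smul_mem _ _ (Submodule.subset_span ⟨j.succ, rfl⟩))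
      (Submodule.smul_mem _ _ (Submodule.subset_span ⟨0, rfl⟩))
  · intro i j hij
    cases i using Fin.cases <;> cases j using Fin.cases
    case zero.zero => exact absurd rfl hij
    case succ.succ i j => exact hv fun h => hij (congrArg Fin.succ h)
    all_goals simp

theorem exists_eq_sum_tmul_of_span_eq_top {R M N ι : Type*} [CommSemiring R] [AddCommMonoid M]
    [AddCommMonoid N] [Module R M] [Module R N] [Fintype ι] {e : ι → N}
    (he : Submodule.span R (Set.range e) = ⊤) (z : M ⊗[R] N) :
    ∃ a : ι → M, z = ∑ i, a i ⊗ₜ[R] e i := by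
  induction z with
  | zero => exact ⟨0, by simp⟩
  | add x y hx hy =>
    obtain ⟨a, rfl⟩ := hx
    obtain ⟨b, rfl⟩ := hy
    exact ⟨a + b, by simp [TensorProduct.add_tmul, Finset.sum_add_distrib]⟩
  | tmul x y =>
    obtain ⟨c, rfl⟩ := (Submodule.mem_span_range_iff_exists_fun R).mp
      (he ▸ Submodule.mem_top : y ∈ Submodule.span R (Set.range e))
    exact ⟨fun i => c i • x, by simp [TensorProduct.tmul_sum, TensorProduct.smul_tmul]⟩

theorem exists_eq_sum_smul_of_isSumOfNSquares {k K A ι : Type*} [CommRing k] [CommRing K]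
    [Algebra k K] [CommRing A] [Algebra k A] [Fintype ι] {s : K →ₗ[k] k} (hs : s 1 = 1) {e : ι → K}
    (he : Submodule.span k (Set.range e) = ⊤) (hort : ∀ i j, i ≠ j → s (e i * e j) = 0)
    {m : ℕ} {f : A} (hf : IsSumOfNSquares m (f ⊗ₜ[k] (1 : K))) :
    ∃ g : ι → A, (∀ i, IsSumOfNSquares m (g i)) ∧ f = ∑ i, s (e i * e i) • g i := by
  classical
  obtain ⟨z, hz⟩ := hf
  choose a ha using fun j => exists_eq_sum_tmul_of_span_eq_top he (z j)
  refine ⟨fun i => ∑ j, a j i ^ 2, fun i => ⟨fun j => a j i, rfl⟩, ?_⟩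
  let S : A ⊗[k] K →ₗ[k] A := (TensorProduct.rid k A).toLinearMap ∘ₗ LinearMap.lTensor A s
  have hS : ∀ x y, S (x ⊗ₜ y) = s y • x := fun x y => by simp [S]
  have hsq : ∀ j, S (z j ^ 2) = ∑ i, s (e i * e i) • a j i ^ 2 := by
    intro j
    rw [ha, sq, Finset.sum_mul_sum, map_sum]
    refine Finset.sum_congr rfl fun i _ => ?_
    rw [map_sum, Finset.sum_eq_single i]
    · rw [Algebra.TensorProduct.tmul_mul_tmul, hS, sq]
    · intro l _ hl
      rw [Algebra.TensorProduct.tmul_mul_tmul, hS, hort i l hl.symm, zero_smul]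
    · simp
  have hf : f = ∑ j, S (z j ^ 2) := by rw [← map_sum, ← hz, hS, hs, one_smul]
  simp_rw [hf, hsq, Finset.smul_sum]
  exact Finset.sum_comm

end Orthogonal

section SumsOfSquares

variable {R : Type*} [CommRing R]

theorem isSumOfNSquares_iff_exists_fintype {n : ℕ} {x : R} {ι : Type*} [Fintype ι]
    (hι : Fintype.card ι = n) : IsSumOfNSquares n x ↔ ∃ g : ι → R, x = ∑ j, g j ^ 2 := by
  let e := Fintype.equivFinOfCardEq hι
  constructor
  · rintro ⟨g, rfl⟩
    exact ⟨g ∘ e, (e.sum_comp fun j => g j ^ 2).symm⟩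
  · rintro ⟨g, rfl⟩
    exact ⟨g ∘ e.symm, (e.symm.sum_comp fun j => g j ^ 2).symm⟩

theorem isSumSq_of_isSumOfNSquares {n : ℕ} {x : R} (hx : IsSumOfNSquares n x) : IsSumSq x := by
  obtain ⟨g, rfl⟩ := hx
  exact IsSumSq.sum fun j _ => by rw [sq]; exact IsSumSq.mul_self _

theorem isSumSq_map {S : Type*} [CommRing S] {x : R} (hx : IsSumSq x) (φ : R →+* S) :
    IsSumSq (φ x) := by
  induction hx with
  | zero => rw [map_zero]; exact .zero
  | sq_add a _ ih => rw [map_add, map_mul]; exact .sq_add _ ih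

theorem isSumSq_sum_smul {k A ι : Type*} [CommRing k] [CommRing A] [Algebra k A] [Fintype ι]
    {c : ι → k} {g : ι → A} (hc : ∀ i, IsSumSq (c i)) (hg : ∀ i, IsSumSq (g i)) :
    IsSumSq (∑ i, c i • g i) :=
  IsSumSq.sum fun i _ => by
    rw [Algebra.smul_def]
    exact (isSumSq_map (hc i) (algebraMap k A)).mul (hg i)

theorem isSumOfNSquares_sum_smul {k A : Type*} [CommRing k] [CommRing A] [Algebra k A] {d m p : ℕ}
    {c : Fin d → k} {g : Fin d → A} (hc : ∀ i, IsSumOfNSquares p (c i))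
    (hg : ∀ i, IsSumOfNSquares m (g i)) : IsSumOfNSquares (d * m * p) (∑ i, c i • g i) := by
  choose a ha using hc
  choose b hb using hg
  refine (isSumOfNSquares_iff_exists_fintype (ι := Fin d × Fin m × Fin p)
    (by simp [mul_assoc])).mpr ⟨fun x => a x.1 x.2.2 • b x.1 x.2.1, ?_⟩
  rw [Fintype.sum_prod_type]
  refine Finset.sum_congr rfl fun i _ => ?_
  rw [Fintype.sum_prod_type, ha i, hb i, Finset.smul_sum]
  refine Finset.sum_congr rfl fun j _ => ?_
  rw [Finset.sum_smul]
  exact Finset.sum_congr rfl fun l _ => (smul_pow _ _ _).symm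

theorem isSumOfNSquares_of_pythagorasNumber_eq {p : ℕ} (hp : pythagorasNumber R = p) {x : R}
    (hx : IsSumSq x) : IsSumOfNSquares p x := by
  have hne : {p : ℕ∞ | ∃ n : ℕ, p = n ∧ ∀ x : R, IsSumSq x → IsSumOfNSquares n x}.Nonempty := by
    by_contra h
    rw [Set.not_nonempty_iff_eq_empty] at h
    rw [pythagorasNumber, h, sInf_empty] at hp
    exact ENat.top_ne_natCast p hp
  obtain ⟨n, hn, h⟩ := csInf_mem hne
  obtain rfl : p = n := by exact_mod_cast hp.symm.trans hn
  exact h x hx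

end SumsOfSquares

theorem theorem1p2 {k K : Type*} [Field k] [Field K] [Algebra k K]
    [IsSemireal k] [IsSemireal K] [FiniteDimensional k K]
    (hext : ∀ P : RingPreordering k, P.IsOrdering →
      (orderingExtensions K P).encard = Module.finrank k K) :
    ∃ c : Fin (Module.finrank k K) → k,
      (∀ i, IsSumSq (c i)) ∧
      c ⟨0, Module.finrank_pos⟩ = 1 ∧
      ∀ (A : Type*) [CommRing A] [Algebra k A] (m : ℕ), 1 ≤ m →
        ∀ f : A, IsSumOfNSquares m (f ⊗ₜ[k] (1 : K)) →
          (∃ g : Fin (Module.finrank k K) → A,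
            (∀ i, IsSumOfNSquares m (g i)) ∧ f = ∑ i, c i • g i) ∧
          IsSumSq f ∧
          ∀ p : ℕ, pythagorasNumber k = p →
            IsSumOfNSquares (Module.finrank k K * m * p) f := by
  have hd : (Module.finrank k K : k) ≠ 0 := Nat.cast_ne_zero.mpr Module.finrank_pos.ne'
  let s : K →ₗ[k] k := (Module.finrank k K : k)⁻¹ • Algebra.trace k K
  have hs : s 1 = 1 := by
    have htrace := Algebra.trace_algebraMap (S := K) (1 : k)
    rw [map_one, nsmul_one] at htrace
    rw [LinearMap.smul_apply, htrace, smul_eq_mul, inv_mul_cancel₀ hd]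
  obtain ⟨e, he0, he, hort⟩ :=
    exists_orthogonal_span_eq_top two_ne_zero s hs rfl Module.finrank_pos
  have hc (i) : IsSumSq (s (e i * e i)) := isSumSq_of_forall_mem_isOrdering fun P hP =>
    mul_mem (RingPreordering.inv_mem (natCast_mem P _))
      (trace_mul_self_mem_of_encard_orderingExtensions hP (hext P hP) (e i))
  refine ⟨fun i => s (e i * e i), hc, by beta_reduce; rw [he0, mul_one, hs],
    fun A _ _ m _ f hf => ?_⟩
  obtain ⟨g, hg, rfl⟩ := exists_eq_sum_smul_of_isSumOfNSquares hs he hort hf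
  exact ⟨⟨g, hg, rfl⟩, isSumSq_sum_smul hc fun i => isSumSq_of_isSumOfNSquares (hg i), fun p hp =>
    isSumOfNSquares_sum_smul (fun i => isSumOfNSquares_of_pythagorasNumber_eq hp (hc i)) hg⟩
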